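/- Let $M$ be a nonempty smooth compact manifold of dimension at least $1$ (possibly with boundary or corners), and let $d$ be a metric inducing its topology. Let $\mathrm{Hom}(M)$ be the set of homeomorphisms of $M$, with the metric $$d_H(f,g)=\max_{x\in M}\max\bigl\{d(f(x),g(x)),\,d(f^{-1}(x),g^{-1}(x))\bigr\}.$$ For $f\in \mathrm{Hom}(M)$, a continuous function $u:M\to\mathbb R$ is a Lyapunov function for $f$ if $u(f(x))\le u(x)$ for all $x\in M$; it is strict if $u(f(x))<u(x)$ for at least one $x\in M$. The generalized recurrent set is $\mathcal{GR}(f)=\bigcap_{\delta}\mathcal{SCR}_\delta(f)$, where $\delta$ runs over all metrics inducing the topology of $M$, and $\mathcal{SCR}_\delta(f)$ is the set of points $x$ such that for every $\varepsilon>0$ there are $n\ge 1$ and points $x=x_1,x_2,\dots,x_{n+1}=x$ in $M$ with $\sum_{i=1}^n\delta(f(x_i),x_{i+1})<\varepsilon$. Then: 1. $(\mathrm{Hom}(M),d_H)$ is a complete metric space. 2. For every $f\in\mathrm{Hom}(M)$, $f$ admits a continuous strict Lyapunov function if and only if $\mathcal{GR}(f)\ne M$. 3. The property of admitting a continuous strict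 Lyapunov function is generic in $\mathrm{Hom}(M)$: the set of $f\in\mathrm{Hom}(M)$ that admit one contains a countable intersection of open dense subsets of $\mathrm{Hom}(M)$. Equivalently, the set of $f$ with $\mathcal{GR}(f)\ne M$ contains such an intersection. -/

import Mathlib

open scoped Manifold ContDiff

namespace GenericLyapunov

/-! ### Generalized recurrence and Lyapunov functions -/

section Recurrence

variable {X : Type*}

/-- There is a strong `ε`-chain for `f` from `x` to `y` with respect to the distance function `d`:
points `x = c 0, c 1, …, c n = y` with `n ≥ 1` and `∑_{i < n} d (f (c i)) (c (i + 1)) < ε`. -/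
def StrongChain (d : X → X → ℝ) (f : X → X) (ε : ℝ) (x y : X) : Prop :=
  ∃ n : ℕ, 1 ≤ n ∧ ∃ c : ℕ → X, c 0 = x ∧ c n = y ∧
    ∑ i ∈ Finset.range n, d (f (c i)) (c (i + 1)) < ε

/-- The strong chain recurrent set `SCR_d(f)`. -/
def strongChainRecurrentSet (d : X → X → ℝ) (f : X → X) : Set X :=
  {x | ∀ ε : ℝ, 0 < ε → StrongChain d f ε x x}

/-- The generalized recurrent set `GR(f)`: the intersection of the sets `SCR_d(f)` over all
metrics `d` that induce the given topology of `X`. -/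
def generalizedRecurrentSet [t : TopologicalSpace X] (f : X → X) : Set X :=
  {x | ∀ m : MetricSpace X, m.toUniformSpace.toTopologicalSpace = t →
    x ∈ strongChainRecurrentSet m.dist f}

/-- `u` is a continuous Lyapunov function for `f`. -/
def IsLyapunov [TopologicalSpace X] (f : X → X) (u : X → ℝ) : Prop :=
  Continuous u ∧ ∀ x, u (f x) ≤ u x

/-- The neutral set of `u`. -/
def neutralSet (f : X → X) (u : X → ℝ) : Set X :=
  {x | u (f x) = u x}

/-- `f` admits a continuous strict Lyapunov function, i.e. a continuous Lyapunov function that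
is not a first integral. -/
def AdmitsStrictLyapunov [TopologicalSpace X] (f : X → X) : Prop :=
  ∃ u : X → ℝ, IsLyapunov f u ∧ neutralSet f u ≠ Set.univ

end Recurrence

/-! ### The space of homeomorphisms of a compact metric space -/

section HomeoMetric

variable {X : Type*} [MetricSpace X]

/-- `d_H(f, g) = max_x max (d (f x) (g x)) (d (f⁻¹ x) (g⁻¹ x))`. -/
noncomputable def homeoDist (f g : X ≃ₜ X) : ℝ :=
  ⨆ x : X, max (dist (f x) (g x)) (dist (f.symm x) (g.symm x))

theorem bddAbove_homeoDist [CompactSpace X] (f g : X ≃ₜ X) :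
    BddAbove (Set.range fun x : X => max (dist (f x) (g x)) (dist (f.symm x) (g.symm x))) :=
  (isCompact_range (by fun_prop)).bddAbove

theorem le_homeoDist [CompactSpace X] (f g : X ≃ₜ X) (x : X) :
    max (dist (f x) (g x)) (dist (f.symm x) (g.symm x)) ≤ homeoDist f g :=
  le_ciSup (bddAbove_homeoDist f g) x

theorem homeoDist_nonneg (f g : X ≃ₜ X) : 0 ≤ homeoDist f g :=
  Real.iSup_nonneg fun _ => le_max_of_le_left dist_nonneg

/-- The metric `d_H` on the set of homeomorphisms of `X`; topological notions about
`X ≃ₜ X` refer to it. -/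
noncomputable instance homeoMetricSpace [CompactSpace X] : MetricSpace (X ≃ₜ X) where
  dist := homeoDist
  dist_self f := by simp [homeoDist]
  dist_comm f g := by simp only [homeoDist, dist_comm]
  dist_triangle f g h := by
    refine Real.iSup_le (fun x => ?_) (add_nonneg (homeoDist_nonneg _ _) (homeoDist_nonneg _ _))
    have h1 := max_le_iff.1 (le_homeoDist f g x)
    have h2 := max_le_iff.1 (le_homeoDist g h x)
    exact max_le ((dist_triangle _ _ _).trans (add_le_add h1.1 h2.1))
      ((dist_triangle _ _ _).trans (add_le_add h1.2 h2.2))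
  eq_of_dist_eq_zero := by
    intro f g h
    ext x
    exact dist_le_zero.1 (((max_le_iff.1 (le_homeoDist f g x)).1).trans h.le)

end HomeoMetric

end GenericLyapunov

/-! If `x` is not strongly chain recurrent for some compatible metric, the infimal cost of chains
from `x` is a Lyapunov function, at most `0` at `f x` and positive at `x`. Conversely, if `u` drops
at `x`, then in the metric `d + |u - u|` a closed chain through `x` must pay back the drop, so `x`
is not in `GR(f)`.

For genericity, `trappingSet` is open, dense and made of maps with a strict Lyapunov function:
Urysohn gives one for an iterate, and summing along orbit segments gives one for the map. Density
(`dense_trappingSet`): finitely many small open cells have dense union, and by Baire some point `s`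
has its whole forward orbit in that union. By pigeonhole the orbit meets some cell twice. Take the
first time this happens, so that the orbit avoids the cell in between. Composing `f` with a
homeomorphism supported in the cell and contracting strongly towards the earlier point closes the
orbit up into a trap. Cells near the boundary or corners lie in the interior of a chart and have the
boundary point in their closure (`hasDenseCells`). -/

namespace GenericLyapunov

open Set Filter Topology

/-! ### Chain costs, Lyapunov functions and generalized recurrence. -/

section Recurrence

variable {X : Type*}

theorem StrongChain.single {d : X → X → ℝ} {f : X → X} (x y : X) {ε : ℝ} (h : d (f x) y < ε) :
    StrongChain d f ε x y :=
  ⟨1, le_rfl, fun i => if i = 0 then x else y, by simp, by simp, by simpa using h⟩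

/-- Prolonging a chain by one step. -/
theorem StrongChain.snoc {d : X → X → ℝ} {f : X → X} {ε ε' : ℝ} {x y z : X}
    (h : StrongChain d f ε x y) (hz : d (f y) z ≤ ε') : StrongChain d f (ε + ε') x z := by
  obtain ⟨n, hn, c, h0, hc, hs⟩ := h
  refine ⟨n + 1, by omega, fun i => if i ≤ n then c i else z, by simpa using h0, by simp, ?_⟩
  rw [Finset.sum_range_succ]
  have : ∑ i ∈ Finset.range n, d (f (if i ≤ n then c i else z)) (if i + 1 ≤ n then c (i + 1) else z)
      = ∑ i ∈ Finset.range n, d (f (c i)) (c (i + 1)) := by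
    refine Finset.sum_congr rfl fun i hi => ?_
    have := Finset.mem_range.1 hi
    rw [if_pos (by omega), if_pos (by omega)]
  simp only [this]
  simpa [hc] using add_lt_add_of_lt_of_le hs hz

/-- Moving the end point of a chain. -/
theorem StrongChain.move {f : X → X} [MetricSpace X] {ε : ℝ} {x y z : X}
    (h : StrongChain dist f ε x y) : StrongChain dist f (ε + dist y z) x z := by
  obtain ⟨n, hn, c, h0, hc, hs⟩ := h
  obtain ⟨n, rfl⟩ : ∃ m, n = m + 1 := ⟨n - 1, by omega⟩
  refine ⟨n + 1, hn, fun i => if i ≤ n then c i else z, by simpa using h0, by simp, ?_⟩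
  rw [Finset.sum_range_succ] at hs ⊢
  have : ∑ i ∈ Finset.range n,
      dist (f (if i ≤ n then c i else z)) (if i + 1 ≤ n then c (i + 1) else z)
      = ∑ i ∈ Finset.range n, dist (f (c i)) (c (i + 1)) := by
    refine Finset.sum_congr rfl fun i hi => ?_
    have := Finset.mem_range.1 hi
    rw [if_pos (by omega), if_pos (by omega)]
  simp only [this]
  have h1 := dist_triangle (f (c n)) y z
  rw [hc] at hs
  simp only [le_refl, if_true, show ¬ n + 1 ≤ n by omega, if_false]
  linarith

/-- The cost of going from `x` to `y` along chains. -/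
noncomputable def chainCost [MetricSpace X] (f : X → X) (x y : X) : ℝ :=
  sInf {ε | StrongChain dist f ε x y}

section Cost

variable [MetricSpace X] {f : X → X} {x y z : X}

theorem StrongChain.pos {ε : ℝ} (h : StrongChain dist f ε x y) : 0 < ε := by
  obtain ⟨n, -, c, -, -, hs⟩ := h
  exact (Finset.sum_nonneg fun _ _ => dist_nonneg).trans_lt hs

theorem bddBelow_chainCost : BddBelow {ε | StrongChain dist f ε x y} :=
  ⟨0, fun _ h => h.pos.le⟩

theorem nonempty_chainCost : {ε | StrongChain dist f ε x y}.Nonempty :=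
  ⟨_, StrongChain.single x y (lt_add_one (dist (f x) y))⟩

theorem chainCost_le_add : chainCost f x z ≤ chainCost f x y + dist y z := by
  rw [← sub_le_iff_le_add]
  exact le_csInf nonempty_chainCost fun ε hε =>
    sub_le_iff_le_add.2 (csInf_le bddBelow_chainCost hε.move)

theorem lipschitzWith_chainCost : LipschitzWith 1 (chainCost f x) :=
  LipschitzWith.of_le_add fun y z => by
    rw [dist_comm]
    exact chainCost_le_add

/-- A chain ending at `y` extends by the step to `f y` at no cost. -/
theorem chainCost_map_le : chainCost f x (f y) ≤ chainCost f x y :=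
  le_csInf nonempty_chainCost fun ε hε =>
    csInf_le bddBelow_chainCost (by simpa using hε.snoc (z := f y) (ε' := 0) (by simp))

theorem chainCost_map_self : chainCost f x (f x) ≤ 0 :=
  le_of_forall_pos_le_add fun ε hε =>
    csInf_le bddBelow_chainCost (StrongChain.single x (f x) (by simpa using hε))

theorem chainCost_self_pos (h : x ∉ strongChainRecurrentSet dist f) : 0 < chainCost f x x := by
  simp only [strongChainRecurrentSet, mem_ofPred_eq, not_forall] at h
  obtain ⟨ε, hε, hn⟩ := h
  refine hε.trans_le (le_csInf nonempty_chainCost fun ε' h' => ?_)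
  by_contra! hlt
  obtain ⟨n, h1, c, h0, hc, hs⟩ := h'
  exact hn ⟨n, h1, c, h0, hc, hs.trans hlt⟩

theorem admitsStrictLyapunov_of_notMem (h : x ∉ strongChainRecurrentSet dist f) :
    AdmitsStrictLyapunov f := by
  refine ⟨chainCost f x, ⟨lipschitzWith_chainCost.continuous, fun y => chainCost_map_le⟩, ?_⟩
  intro hu
  have : chainCost f x (f x) = chainCost f x x := hu.ge (mem_univ x)
  linarith [chainCost_self_pos h, chainCost_map_self (f := f) (x := x)]

end Cost

/-- The metric `d(x, y) + |u x - u y|`. -/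
noncomputable abbrev graphMetric [MetricSpace X] (u : X → ℝ) (hu : Continuous u) : MetricSpace X :=
  MetricSpace.ofDistTopology (fun x y => dist x y + dist (u x) (u y)) (by simp)
    (fun x y => by simp only [dist_comm])
    (fun x y z => by linarith [dist_triangle x y z, dist_triangle (u x) (u y) (u z)])
    (fun s => by
      rw [Metric.isOpen_iff]
      refine forall₂_congr fun x _ => ⟨?_, ?_⟩
      · rintro ⟨ε, hε, h⟩
        refine ⟨ε, hε, fun y hy => h ?_⟩
        rw [Metric.mem_ball, dist_comm]
        linarith [dist_nonneg (x := u x) (y := u y)]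
      · rintro ⟨ε, hε, h⟩
        have hc : Continuous fun y => dist x y + dist (u x) (u y) := by fun_prop
        obtain ⟨δ, hδ, hd⟩ := Metric.mem_nhds_iff.1
          ((isOpen_Iio.preimage hc).mem_nhds (show x ∈ _ from by simpa using hε))
        exact ⟨δ, hδ, fun y hy => h y (hd hy)⟩)
    (fun x y h => dist_le_zero.1 (by linarith [dist_nonneg (x := u x) (y := u y)]))

/-- `u` can rise only in the jumps, and each jump costs at least its rise. Starting at `u (f (c 0))`
rather than `u (c 0)` keeps the strict drop at the first point. -/
theorem IsLyapunov.le_sum_of_chain [MetricSpace X] {f : X → X} {u : X → ℝ} (hu : IsLyapunov f u)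
    (c : ℕ → X) (n : ℕ) :
    u (c (n + 1)) ≤ u (f (c 0)) +
      ∑ i ∈ Finset.range (n + 1),
        (dist (f (c i)) (c (i + 1)) + dist (u (f (c i))) (u (c (i + 1)))) := by
  have key : ∀ i, u (c (i + 1)) ≤
      u (f (c i)) + (dist (f (c i)) (c (i + 1)) + dist (u (f (c i))) (u (c (i + 1)))) := fun i => by
    have := neg_abs_le (u (f (c i)) - u (c (i + 1)))
    rw [Real.dist_eq]
    linarith [dist_nonneg (x := f (c i)) (y := c (i + 1))]
  induction n with
  | zero => simpa using key 0
  | succ n ih =>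
    rw [Finset.sum_range_succ]
    linarith [key (n + 1), hu.2 (c (n + 1))]

theorem admitsStrictLyapunov_iff [t : MetricSpace X] (f : X → X) :
    AdmitsStrictLyapunov f ↔ generalizedRecurrentSet f ≠ univ := by
  constructor
  · rintro ⟨u, hu, hne⟩ h
    obtain ⟨x, hx⟩ := (ne_univ_iff_exists_notMem _).1 hne
    have hlt : u (f x) < u x := lt_of_le_of_ne (hu.2 x) hx
    have hx' : x ∈ generalizedRecurrentSet f := h ▸ mem_univ x
    -- `rfl` works because `MetricSpace.ofDistTopology` keeps the given topology definitionally.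
    obtain ⟨n, hn, c, h0, hc, hs⟩ := hx' (graphMetric u hu.1) rfl (u x - u (f x)) (by linarith)
    obtain ⟨n, rfl⟩ : ∃ m, n = m + 1 := ⟨n - 1, by omega⟩
    have := hu.le_sum_of_chain c n
    rw [h0, hc] at this
    change ∑ i ∈ _, (dist _ _ + dist _ _) < _ at hs
    linarith
  · intro h
    obtain ⟨x, hx⟩ := (ne_univ_iff_exists_notMem _).1 h
    simp only [generalizedRecurrentSet, mem_ofPred_eq, not_forall] at hx
    obtain ⟨m, hm, hx⟩ := hx
    have := @admitsStrictLyapunov_of_notMem X m f x hx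
    rwa [hm] at this

/-- A Lyapunov function for an iterate, summed along the orbit, is one for the map. -/
theorem AdmitsStrictLyapunov.of_iterate [TopologicalSpace X] {f : X → X} (hf : Continuous f) {k : ℕ}
    (h : AdmitsStrictLyapunov f^[k]) : AdmitsStrictLyapunov f := by
  obtain ⟨u, ⟨huc, hu⟩, hne⟩ := h
  have key : ∀ x, ∑ i ∈ Finset.range k, u (f^[i] (f x)) + u x =
      ∑ i ∈ Finset.range k, u (f^[i] x) + u (f^[k] x) := fun x => by
    rw [← Finset.sum_range_succ (fun i => u (f^[i] x)), Finset.sum_range_succ']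
    simp [Function.iterate_succ_apply]
  refine ⟨fun x => ∑ i ∈ Finset.range k, u (f^[i] x),
    ⟨continuous_finsetSum _ fun i _ => huc.comp (hf.iterate i), fun x => ?_⟩, ?_⟩
  · linarith [key x, hu x]
  · obtain ⟨x, hx⟩ := (ne_univ_iff_exists_notMem _).1 hne
    refine (ne_univ_iff_exists_notMem _).2 ⟨x, fun h => hx ?_⟩
    have h : ∑ i ∈ Finset.range k, u (f^[i] (f x)) = ∑ i ∈ Finset.range k, u (f^[i] x) := h
    show u (f^[k] x) = u x
    linarith [key x]

/-- A Urysohn function that is `0` on `f '' A` and `1` off `W` works: it vanishes after a step from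
`A`, is `1` outside `A`, and drops on `A \ W`. -/
theorem admitsStrictLyapunov_of_mapsTo [TopologicalSpace X] [T2Space X] [CompactSpace X] {f : X → X}
    (hf : Continuous f) {A W : Set X} (hA : IsCompact A) (hW : IsOpen W) (hWA : W ⊂ A)
    (h : MapsTo f A W) : AdmitsStrictLyapunov f := by
  obtain ⟨u, h0, h1, hI⟩ := exists_continuous_zero_one_of_isClosed (hA.image hf).isClosed
    hW.isClosed_compl (disjoint_compl_right_iff_subset.2 h.image_subset)
  refine ⟨u, ⟨u.continuous, fun x => ?_⟩, ?_⟩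
  · by_cases hx : x ∈ A
    · rw [h0 (mem_image_of_mem f hx)]
      exact (hI x).1
    · rw [h1 (fun hx' => hx (hWA.1 hx'))]
      exact (hI _).2
  · obtain ⟨x, hx, hxW⟩ := exists_of_ssubset hWA
    refine (ne_univ_iff_exists_notMem _).2 ⟨x, fun h => ?_⟩
    have h : u (f x) = u x := h
    rw [h0 (mem_image_of_mem f hx), h1 hxW] at h
    exact zero_ne_one h

end Recurrence

/-! ### Completeness of the homeomorphism space and openness of trapping. -/

section HomeoSpace

variable {X : Type*} [MetricSpace X] [CompactSpace X]

theorem dist_apply_le (f g : X ≃ₜ X) (x : X) : dist (f x) (g x) ≤ dist f g :=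
  (max_le_iff.1 (le_homeoDist f g x)).1

theorem dist_symm_apply_le (f g : X ≃ₜ X) (x : X) : dist (f.symm x) (g.symm x) ≤ dist f g :=
  (max_le_iff.1 (le_homeoDist f g x)).2

theorem dist_homeo_le {f g : X ≃ₜ X} {r : ℝ} (hr : 0 ≤ r) (h : ∀ x, dist (f x) (g x) ≤ r)
    (h' : ∀ x, dist (f.symm x) (g.symm x) ≤ r) : dist f g ≤ r :=
  Real.iSup_le (fun x => max_le (h x) (h' x)) hr

theorem lipschitzWith_toContinuousMap : LipschitzWith 1 fun f : X ≃ₜ X => (f : C(X, X)) :=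
  LipschitzWith.of_dist_le_mul fun f g => by
    simpa using (ContinuousMap.dist_le dist_nonneg).2 (dist_apply_le f g)

theorem lipschitzWith_symm_toContinuousMap :
    LipschitzWith 1 fun f : X ≃ₜ X => (f.symm : C(X, X)) :=
  LipschitzWith.of_dist_le_mul fun f g => by
    simpa using (ContinuousMap.dist_le dist_nonneg).2 (dist_symm_apply_le f g)

/-- The metric controls inverses too, so both maps and inverses converge uniformly, and the two
limits are mutually inverse. -/
theorem completeSpace_homeo : CompleteSpace (X ≃ₜ X) := by
  refine Metric.complete_of_cauchySeq_tendsto fun u hu => ?_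
  obtain ⟨F, hF⟩ := cauchySeq_tendsto_of_complete
    (lipschitzWith_toContinuousMap.uniformContinuous.comp_cauchySeq hu)
  obtain ⟨G, hG⟩ := cauchySeq_tendsto_of_complete
    (lipschitzWith_symm_toContinuousMap.uniformContinuous.comp_cauchySeq hu)
  have hFG : F.comp G = ContinuousMap.id X :=
    tendsto_nhds_unique (hF.compCM hG) (tendsto_const_nhds.congr fun n => by ext x; simp)
  have hGF : G.comp F = ContinuousMap.id X :=
    tendsto_nhds_unique (hG.compCM hF) (tendsto_const_nhds.congr fun n => by ext x; simp)
  refine ⟨⟨⟨F, G, fun x => DFunLike.congr_fun hGF x, fun x => DFunLike.congr_fun hFG x⟩,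
    F.continuous, G.continuous⟩, ?_⟩
  rw [Metric.tendsto_atTop] at hF hG ⊢
  intro ε hε
  obtain ⟨N, hN⟩ := hF (ε / 2) (half_pos hε)
  obtain ⟨N', hN'⟩ := hG (ε / 2) (half_pos hε)
  refine ⟨max N N', fun n hn => (dist_homeo_le (half_pos hε).le (fun x => ?_) fun x => ?_).trans_lt
    (half_lt_self hε)⟩
  · exact (ContinuousMap.dist_apply_le_dist x).trans (hN n (le_of_max_le_left hn)).le
  · exact (ContinuousMap.dist_apply_le_dist x).trans (hN' n (le_of_max_le_right hn)).le

/-- The homeomorphisms some iterate of which maps a compact set `A` into an open proper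
subset of `A`. -/
def trappingSet (X : Type*) [MetricSpace X] : Set (X ≃ₜ X) :=
  {g | ∃ (k : ℕ) (A W : Set X), IsCompact A ∧ IsOpen W ∧ W ⊂ A ∧ MapsTo g^[k] A W}

theorem admitsStrictLyapunov_of_mem_trappingSet {g : X ≃ₜ X} (hg : g ∈ trappingSet X) :
    AdmitsStrictLyapunov g := by
  obtain ⟨k, A, W, hA, hW, hWA, h⟩ := hg
  exact .of_iterate g.continuous
    (admitsStrictLyapunov_of_mapsTo (g.continuous.iterate k) hA hW hWA h)

theorem exists_continuous_iterate (k : ℕ) :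
    ∃ F : (X ≃ₜ X) → C(X, X), Continuous F ∧ ∀ g, ⇑(F g) = g^[k] := by
  induction k with
  | zero => exact ⟨fun _ => .id X, continuous_const, fun _ => rfl⟩
  | succ k ih =>
    obtain ⟨F, hF, h⟩ := ih
    exact ⟨fun g => (F g).comp (g : C(X, X)), hF.compCM lipschitzWith_toContinuousMap.continuous,
      fun g => by rw [Function.iterate_succ, ← h]; rfl⟩

theorem isOpen_trappingSet : IsOpen (trappingSet X) := by
  refine isOpen_iff_mem_nhds.2 fun g ⟨k, A, W, hA, hW, hWA, h⟩ => ?_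
  obtain ⟨F, hF, hFk⟩ := exists_continuous_iterate (X := X) k
  rw [← hFk] at h
  filter_upwards [hF.continuousAt.eventually (ContinuousMap.eventually_mapsTo hA hW h)] with g' hg'
  exact ⟨k, A, W, hA, hW, hWA, hFk g' ▸ hg'⟩

end HomeoSpace

/-! ### Radial contractions of a normed space and their extension by the identity. -/

section Contraction

/-- The scaling factor equal to `l` up to `R` and to `1` from `2 * R` on. -/
noncomputable def scaleFactor (l R t : ℝ) : ℝ := min 1 (max l (l + (1 - l) * (t / R - 1)))

variable {l R : ℝ}

theorem continuous_scaleFactor : Continuous (scaleFactor l R) := by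
  unfold scaleFactor; fun_prop

theorem scaleFactor_pos (hl : 0 < l) (t : ℝ) : 0 < scaleFactor l R t :=
  lt_min one_pos (lt_max_of_lt_left hl)

theorem monotone_scaleFactor (hl : l ≤ 1) (hR : 0 < R) : Monotone (scaleFactor l R) := by
  intro s t h
  unfold scaleFactor
  have : 0 ≤ 1 - l := by linarith
  gcongr

theorem scaleFactor_of_le (hl : l ≤ 1) (hR : 0 < R) {t : ℝ} (ht : t ≤ R) :
    scaleFactor l R t = l := by
  have h1 : t / R - 1 ≤ 0 := by rw [sub_nonpos, div_le_one hR]; exact ht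
  rw [scaleFactor, max_eq_left, min_eq_right hl]
  nlinarith

theorem scaleFactor_of_ge (hl : l ≤ 1) (hR : 0 < R) {t : ℝ} (ht : 2 * R ≤ t) :
    scaleFactor l R t = 1 := by
  have h1 : 1 ≤ t / R - 1 := by
    rw [le_sub_iff_add_le, le_div_iff₀ hR]; linarith
  rw [scaleFactor, min_eq_left]
  exact le_max_of_le_right (by nlinarith)

theorem strictMonoOn_mul_scaleFactor (hl : 0 < l) (hl1 : l ≤ 1) (hR : 0 < R) :
    StrictMonoOn (fun t => scaleFactor l R t * t) (Ici 0) := by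
  intro s hs t _ h
  have hm := monotone_scaleFactor hl1 hR h.le
  have hp := scaleFactor_pos (R := R) hl t
  have hs : 0 ≤ s := hs
  show scaleFactor l R s * s < scaleFactor l R t * t
  nlinarith

variable {E : Type*} [NormedAddCommGroup E] [NormedSpace ℝ E]

/-- Rays are preserved, and on each the radius changes by `t ↦ scaleFactor l R t * t`, strictly
increasing and onto by the intermediate value theorem. -/
theorem bijective_scaleFactor_smul (hl : 0 < l) (hl1 : l ≤ 1) (hR : 0 < R) :
    Function.Bijective fun x : E => scaleFactor l R ‖x‖ • x := by
  have hnorm : ∀ x : E, ‖scaleFactor l R ‖x‖ • x‖ = scaleFactor l R ‖x‖ * ‖x‖ := fun x => by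
    rw [norm_smul, Real.norm_of_nonneg (scaleFactor_pos hl _).le]
  constructor
  · intro x y h
    have hn : ‖x‖ = ‖y‖ := (strictMonoOn_mul_scaleFactor hl hl1 hR).injOn (norm_nonneg x)
      (norm_nonneg y) (by simpa [hnorm] using congrArg norm h)
    simp only [hn] at h
    exact smul_right_injective E (scaleFactor_pos hl _).ne' h
  · intro y
    rcases eq_or_ne y 0 with rfl | hy
    · exact ⟨0, by simp⟩
    have hy' : 0 < ‖y‖ := norm_pos_iff.2 hy
    have hT : ‖y‖ ≤ max (2 * R) ‖y‖ := le_max_right _ _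
    obtain ⟨t, ht, hty⟩ : ‖y‖ ∈ (fun t => scaleFactor l R t * t) '' Icc 0 (max (2 * R) ‖y‖) := by
      refine intermediate_value_Icc (hy'.le.trans hT)
        ((continuous_scaleFactor.mul continuous_id).continuousOn) ⟨by simp, ?_⟩
      show ‖y‖ ≤ scaleFactor l R _ * _
      rw [scaleFactor_of_ge hl1 hR (le_max_left _ _), one_mul]
      exact hT
    refine ⟨(t / ‖y‖) • y, ?_⟩
    have : ‖(t / ‖y‖) • y‖ = t := by
      rw [norm_smul, Real.norm_of_nonneg (div_nonneg ht.1 hy'.le), div_mul_cancel₀ _ hy'.ne']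
    simp only [this, smul_smul]
    rw [← mul_div_assoc]
    simp only at hty
    rw [hty, div_self hy'.ne', one_smul]

/-- A compactly supported homeomorphism contracting the ball of radius `R` into a smaller one. -/
theorem exists_contraction (b : E) (hR : 0 < R) {r : ℝ} (hr : 0 < r) :
    ∃ η : Equiv.Perm E, Continuous η ∧ (∀ x ∉ Metric.closedBall b (2 * R), η x = x) ∧
      MapsTo η (Metric.ball b R) (Metric.ball b r) := by
  set l := min 1 (r / R)
  have hl : 0 < l := lt_min one_pos (div_pos hr hR)
  have hl1 : l ≤ 1 := min_le_left _ _
  have hlr : l * R ≤ r := (le_div_iff₀ hR).1 (min_le_right _ _)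
  obtain ⟨η, happ⟩ : ∃ η : Equiv.Perm E, ∀ x, η x = scaleFactor l R ‖x - b‖ • (x - b) + b :=
    ⟨(Equiv.subRight b).trans
      ((Equiv.ofBijective _ (bijective_scaleFactor_smul hl hl1 hR)).trans (Equiv.addRight b)),
      fun x => rfl⟩
  refine ⟨η, ?_, fun x hx => ?_, fun x hx => ?_⟩
  · simp only [funext happ]
    exact (((continuous_scaleFactor.comp (by fun_prop)).smul (by fun_prop)).add continuous_const)
  · rw [happ, scaleFactor_of_ge hl1 hR, one_smul, sub_add_cancel]
    rw [Metric.mem_closedBall, dist_eq_norm] at hx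
    linarith
  · rw [Metric.mem_ball, dist_eq_norm] at hx
    rw [happ, Metric.mem_ball, dist_eq_norm, scaleFactor_of_le hl1 hR hx.le, add_sub_cancel_right,
      norm_smul, Real.norm_of_nonneg hl.le]
    exact (mul_lt_mul_of_pos_left hx hl).trans_le hlr

/-- Extension by the identity of a compactly supported self-homeomorphism along an open
embedding. -/
theorem exists_homeo_extension {E X : Type*} [TopologicalSpace E] [TopologicalSpace X] [T2Space X]
    [CompactSpace X]
    {Φ : E → X} (hΦ : IsOpenEmbedding Φ) {η : Equiv.Perm E} (hη : Continuous η) {K : Set E}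
    (hK : IsCompact K) (hηK : ∀ x ∉ K, η x = x) :
    ∃ h : X ≃ₜ X, (∀ x, h (Φ x) = Φ (η x)) ∧ ∀ x ∉ Φ '' K, h x = x := by
  set e := η.viaEmbedding ⟨Φ, hΦ.injective⟩
  have he : ∀ x, e (Φ x) = Φ (η x) := η.viaEmbedding_apply ⟨Φ, hΦ.injective⟩
  have heK : ∀ x ∉ Φ '' K, e x = x := by
    intro x hx
    by_cases hr : x ∈ range Φ
    · obtain ⟨y, rfl⟩ := hr
      rw [he, hηK y fun hy => hx (mem_image_of_mem Φ hy)]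
    · exact η.viaEmbedding_apply_of_notMem _ x hr
  have hc : Continuous e := continuous_iff_continuousAt.2 fun x => by
    by_cases hx : x ∈ Φ '' K
    · obtain ⟨y, -, rfl⟩ := hx
      rw [← hΦ.continuousAt_iff]
      exact ((hΦ.continuous.comp hη).congr fun y => (he y).symm).continuousAt
    · have : (Φ '' K)ᶜ ∈ 𝓝 x := (hK.image hΦ.continuous).isClosed.isOpen_compl.mem_nhds hx
      exact continuousAt_id.congr (by filter_upwards [this] with y hy using (heK y hy).symm)
  exact ⟨hc.homeoOfEquivCompactToT2, he, heK⟩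

end Contraction

/-! ### Density of trapping by closing up an orbit segment. -/

section Density

theorem dist_le_of_eq_off {X : Type*} [MetricSpace X] {s : Set X} {z : X} {ε : ℝ}
    (hε : 0 ≤ ε) (hs : s ⊆ Metric.ball z ε)
    {h : X → X} (h₁ : ∀ x ∈ s, h x ∈ s) (h₂ : ∀ x ∉ s, h x = x) (x : X) :
    dist x (h x) ≤ 2 * ε := by
  by_cases hx : x ∈ s
  · have h3 := Metric.mem_ball.1 (hs hx)
    have h4 := Metric.mem_ball.1 (hs (h₁ x hx))
    linarith [dist_triangle_right x (h x) z]
  · rw [h₂ x hx, dist_self]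
    positivity

variable {E : Type*} [NormedAddCommGroup E] [NormedSpace ℝ E] [FiniteDimensional ℝ E]
  {X : Type*} [MetricSpace X] [CompactSpace X]

/-- Composing with a homeomorphism supported in a cell that meets the orbit segment of `b` only at
both ends, one makes a neighbourhood of `b` periodic and attracting. -/
theorem exists_comp_mem_trappingSet [Nontrivial E] {Φ : E → X} (hΦ : IsOpenEmbedding Φ)
    (f : X ≃ₜ X) {k : ℕ} {a b : E} (hk : 1 ≤ k) (hab : f^[k] (Φ b) = Φ a)
    (hav : ∀ i, 0 < i → i < k → f^[i] (Φ b) ∉ range Φ) :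
    ∃ h : X ≃ₜ X, (∀ x, h (Φ x) ∈ range Φ) ∧ (∀ x ∉ range Φ, h x = x) ∧
      f.trans h ∈ trappingSet X := by
  -- Large enough that the ball around `b` contains `a`.
  set R := dist a b + 1
  have hR : 0 < R := by positivity
  have hK : IsCompact (Metric.closedBall b (2 * R)) := isCompact_closedBall b _
  have hfc : ∀ i, Continuous fun x => f^[i] (Φ x) := fun i =>
    (f.continuous.iterate i).comp hΦ.continuous
  have hev : ∀ᶠ x in 𝓝 b, (∀ i ∈ Ioo 0 k, f^[i] (Φ x) ∈ (Φ '' Metric.closedBall b (2 * R))ᶜ) ∧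
      f^[k] (Φ x) ∈ Φ '' Metric.ball b R := by
    refine ((eventually_all_finite (finite_Ioo 0 k)).2 fun i hi => ?_).and ?_
    · exact (hfc i).continuousAt.eventually_mem
        ((hK.image hΦ.continuous).isClosed.isOpen_compl.mem_nhds fun h =>
          hav i hi.1 hi.2 (image_subset_range _ _ h))
    · refine (hfc k).continuousAt.eventually_mem
        ((hΦ.isOpenMap _ Metric.isOpen_ball).mem_nhds ?_)
      rw [hab]
      exact mem_image_of_mem Φ (lt_add_one (dist a b))
  obtain ⟨r, hr, hball⟩ := Metric.nhds_basis_closedBall.eventually_iff.1 hev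
  obtain ⟨η, hη, hηK, hηr⟩ := exists_contraction b hR hr
  obtain ⟨h, hh, hhK⟩ := exists_homeo_extension hΦ hη hK hηK
  refine ⟨h, fun x => hh x ▸ mem_range_self _,
    fun x hx => hhK x fun hx' => hx (image_subset_range _ _ hx'),
    k, Φ '' Metric.closedBall b r, Φ '' Metric.ball b r,
    (isCompact_closedBall b r).image hΦ.continuous, hΦ.isOpenMap _ Metric.isOpen_ball,
    hΦ.injective.image_strictMono ?_, ?_⟩
  · refine Metric.ball_subset_closedBall.ssubset_of_ne fun h => ?_
    -- Positive dimension enters here: in dimension zero the open and closed balls coincide.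
    obtain ⟨x, hx⟩ := NormedSpace.sphere_nonempty (x := b).2 hr.le
    exact (Metric.mem_ball.1 (h.ge (Metric.sphere_subset_closedBall hx))).ne hx
  · rintro _ ⟨x, hx, rfl⟩
    obtain ⟨hi, hk'⟩ := hball hx
    -- Before time `k` the orbit misses the support of `h`, so `h` acts only at the last step.
    have hit : ∀ i < k, (f.trans h)^[i] (Φ x) = f^[i] (Φ x) := by
      intro i
      induction i with
      | zero => simp
      | succ i ih =>
        intro hik
        rw [Function.iterate_succ_apply', ih (by omega), Homeomorph.trans_apply,
          ← Function.iterate_succ_apply' f, hhK _ (hi _ ⟨by omega, hik⟩)]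
    obtain ⟨k, rfl⟩ : ∃ m, k = m + 1 := ⟨k - 1, by omega⟩
    rw [Function.iterate_succ_apply', hit k (by omega), Homeomorph.trans_apply,
      ← Function.iterate_succ_apply' f]
    obtain ⟨y, hy, hyx⟩ := hk'
    rw [← hyx, hh]
    exact mem_image_of_mem Φ (hηr hy)

/-- Every point has a neighbourhood in which a small open cell is dense. -/
def HasDenseCells (E X : Type*) [TopologicalSpace E] [MetricSpace X] : Prop :=
  ∀ (z : X) (ε : ℝ), 0 < ε → ∃ N ∈ 𝓝 z, ∃ Φ : E → X, IsOpenEmbedding Φ ∧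
    range Φ ⊆ Metric.ball z ε ∧ N ⊆ closure (range Φ)

theorem dense_trappingSet [Nontrivial E] [Nonempty X] (hX : HasDenseCells E X) :
    Dense (trappingSet X) := by
  refine Metric.dense_iff.2 fun f ε hε => ?_
  obtain ⟨δ, hδ, hfδ⟩ := Metric.uniformContinuous_iff.1
    (CompactSpace.uniformContinuous_of_continuous f.symm.continuous) (ε / 2) (half_pos hε)
  -- `h` moves points by at most `2 * ρ`: this must be below `δ` for the inverses and at most `ε /
  -- 2` for the maps.
  set ρ := min δ ε / 5
  have hρ : 0 < ρ := div_pos (lt_min hδ hε) (by norm_num)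
  have hρδ : 2 * ρ < δ := by
    have : ρ ≤ δ / 5 := div_le_div_of_nonneg_right (min_le_left _ _) (by norm_num)
    linarith
  have hρε : 2 * ρ ≤ ε / 2 := by
    have : ρ ≤ ε / 5 := div_le_div_of_nonneg_right (min_le_right _ _) (by norm_num)
    linarith
  choose N hN Φ hΦ hΦρ hNΦ using fun z => hX z ρ hρ
  obtain ⟨t, ht⟩ := CompactSpace.elim_nhds_subcover N hN
  have hDo : IsOpen (⋃ z ∈ t, range (Φ z)) := isOpen_biUnion fun z _ => (hΦ z).isOpen_range
  have hDd : Dense (⋃ z ∈ t, range (Φ z)) := fun x => by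
    obtain ⟨z, hz, hx⟩ := mem_iUnion₂.1 (ht.ge (mem_univ x))
    exact closure_mono (subset_biUnion_of_mem (u := fun z => range (Φ z)) hz) (hNΦ z hx)
  have hit : ∀ n, ∃ F : X ≃ₜ X, ⇑F = f^[n] := fun n => by
    induction n with
    | zero => exact ⟨.refl X, rfl⟩
    | succ n ih =>
      obtain ⟨F, hF⟩ := ih
      exact ⟨f.trans F, by rw [Function.iterate_succ, ← hF]; rfl⟩
  obtain ⟨s, hs⟩ : (⋂ n : ℕ, f^[n] ⁻¹' ⋃ z ∈ t, range (Φ z)).Nonempty := by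
    refine (dense_iInter_of_isOpen (fun n => hDo.preimage (f.continuous.iterate n))
      fun n => ?_).nonempty
    obtain ⟨F, hF⟩ := hit n
    rw [← hF]
    exact hDd.preimage F.isOpenMap
  have hs : ∀ n, ∃ z : t, f^[n] s ∈ range (Φ z) := fun n => by
    simpa using mem_iInter.1 hs n
  have hex : ∃ m, ∃ n < m, ∃ z, f^[m] s ∈ range (Φ z) ∧ f^[n] s ∈ range (Φ z) := by
    choose z hz using hs
    obtain ⟨m, n, hmn, hz'⟩ := Finite.exists_ne_map_eq_of_infinite z
    rcases hmn.lt_or_gt with h | h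
    · exact ⟨n, m, h, z n, hz n, hz' ▸ hz m⟩
    · exact ⟨m, n, h, z m, hz m, hz' ▸ hz n⟩
  classical
  -- Minimality of the later time keeps the intermediate iterates out of the cell `z`.
  obtain ⟨n, hnm, z, ⟨a, ha⟩, ⟨b, hb⟩⟩ := Nat.find_spec hex
  have hmin := fun j (hj : j < Nat.find hex) => Nat.find_min hex hj
  generalize Nat.find hex = m at *
  obtain ⟨h, hh₁, hh₂, hmem⟩ := exists_comp_mem_trappingSet (hΦ z) f (k := m - n) (a := a) (b := b)
    (by omega) (by rw [hb, ← Function.iterate_add_apply, ha, Nat.sub_add_cancel hnm.le])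
    (fun i h0 hi hr => hmin (i + n) (by omega)
      ⟨n, by omega, z, by rwa [Function.iterate_add_apply, ← hb], b, hb⟩)
  refine ⟨f.trans h, ?_, hmem⟩
  have hd : ∀ x, dist x (h x) ≤ 2 * ρ := dist_le_of_eq_off hρ.le (hΦρ z)
    (by rintro _ ⟨x, rfl⟩; exact hh₁ x) hh₂
  rw [Metric.mem_ball, dist_comm]
  refine (dist_homeo_le (half_pos hε).le (fun x => ?_) fun x => ?_).trans_lt (half_lt_self hε)
  · exact (hd (f x)).trans hρε
  · refine (hfδ (lt_of_le_of_lt ?_ hρδ)).le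
    have := hd (h.symm x)
    rwa [h.apply_symm_apply, dist_comm] at this

theorem trappingSet_mem_residual [Nontrivial E] [Nonempty X] (hX : HasDenseCells E X) :
    trappingSet X ∈ residual (X ≃ₜ X) :=
  residual_of_dense_open isOpen_trappingSet (dense_trappingSet hX)

end Density

/-! ### Dense cells in manifolds with corners. -/

section Manifold

variable {E : Type*} [NormedAddCommGroup E] [NormedSpace ℝ E]

/-- A bounded nonempty open convex set is the image of an open embedding of the whole space. -/
theorem exists_openPartialHomeomorph_of_convex {C : Set E} (hC : Convex ℝ C) (ho : IsOpen C)
    (hne : C.Nonempty) (hb : Bornology.IsBounded C) :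
    ∃ ψ : OpenPartialHomeomorph E E, ψ.source = univ ∧ ψ.target = C := by
  obtain ⟨h, hh, -⟩ := exists_homeomorph_image_interior_closure_frontier_eq_unitBall hC
    (by rwa [ho.interior_eq]) hb
  rw [ho.interior_eq] at hh
  refine ⟨OpenPartialHomeomorph.univUnitBall.transHomeomorph h.symm, rfl, ?_⟩
  show h.symm.symm ⁻¹' Metric.ball 0 1 = C
  rw [← hh]
  exact preimage_image_eq C h.injective

/-- In a chart, intersect the interior of `range I` with a small ball: this is open, convex and
bounded, hence a cell, and its closure contains all of `range I` in that ball. -/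
theorem hasDenseCells {H : Type*} [TopologicalSpace H] (I : ModelWithCorners ℝ E H)
    {M : Type*} [MetricSpace M] [ChartedSpace H M] : HasDenseCells E M := by
  intro z ε hε
  set e := extChartAt I z
  have hmem : e.target ∩ e.symm ⁻¹' Metric.ball z ε ∈ 𝓝[range I] (e z) := by
    refine inter_mem (extChartAt_target_mem_nhdsWithin z) ?_
    refine (continuousAt_extChartAt_symm z).continuousWithinAt.preimage_mem_nhdsWithin ?_
    rw [extChartAt_to_inv]
    exact Metric.ball_mem_nhds z hε
  obtain ⟨r, hr, hrs⟩ := Metric.mem_nhdsWithin_iff.1 hmem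
  set C := interior (range I) ∩ Metric.ball (e z) r
  have hCo : IsOpen C := isOpen_interior.inter Metric.isOpen_ball
  have hCsub : C ⊆ e.target ∩ e.symm ⁻¹' Metric.ball z ε := fun y hy =>
    hrs ⟨hy.2, interior_subset hy.1⟩
  have hCcl : range I ∩ Metric.ball (e z) r ⊆ closure C := fun y hy => by
    simp only [C, inter_comm (interior _)]
    exact Metric.isOpen_ball.inter_closure ⟨hy.2, I.range_subset_closure_interior hy.1⟩
  have hzr : e z ∈ range I ∩ Metric.ball (e z) r :=
    ⟨extChartAt_target_subset_range z (mem_extChartAt_target z), Metric.mem_ball_self hr⟩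
  obtain ⟨ψ, hψs, hψt⟩ := exists_openPartialHomeomorph_of_convex
    (I.convex_range.interior.inter (convex_ball _ _)) hCo (closure_nonempty_iff.1 ⟨_, hCcl hzr⟩)
    (Metric.isBounded_ball.subset inter_subset_right)
  have hop : ∀ s, IsOpen s → IsOpen (e.source ∩ e ⁻¹' s) := fun s hs =>
    (continuousOn_extChartAt z).isOpen_inter_preimage (isOpen_extChartAt_source z) hs
  let Q : OpenPartialHomeomorph E M :=
    { toFun := e.symm
      invFun := e
      source := C
      target := e.source ∩ e ⁻¹' C
      map_source' := fun y hy => ⟨e.map_target (hCsub hy).1, by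
        rwa [mem_preimage, e.right_inv (hCsub hy).1]⟩
      map_target' := fun x hx => hx.2
      left_inv' := fun y hy => e.right_inv (hCsub hy).1
      right_inv' := fun x hx => e.left_inv hx.1
      open_source := hCo
      open_target := hop C hCo
      continuousOn_toFun := (continuousOn_extChartAt_symm z).mono fun y hy => (hCsub hy).1
      continuousOn_invFun := (continuousOn_extChartAt z).mono inter_subset_left }
  let P := ψ.trans' Q hψt
  have hPs : P.source = univ := hψs
  have hPr : range P = e.symm '' C := by
    rw [← image_univ, ← hPs, P.image_source_eq_target]
    exact Q.image_source_eq_target.symm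
  refine ⟨e.source ∩ e ⁻¹' Metric.ball (e z) r,
    (hop _ Metric.isOpen_ball).mem_nhds ⟨mem_extChartAt_source z, hzr.2⟩, P,
    P.isOpenEmbedding hPs, ?_, fun x hx => ?_⟩
  · rw [hPr]
    rintro _ ⟨y, hy, rfl⟩
    exact (hCsub hy).2
  · have hxt : e x ∈ e.target := e.map_source hx.1
    have hcw : ContinuousWithinAt e.symm C (e x) :=
      ((continuousOn_extChartAt_symm z) _ hxt).mono fun y hy => (hCsub hy).1
    have := hcw.mem_closure_image (hCcl ⟨extChartAt_target_subset_range z hxt, hx.2⟩)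
    rwa [e.left_inv hx.1, ← hPr] at this

end Manifold

end GenericLyapunov

theorem mainTheorem10
    {E : Type*} [NormedAddCommGroup E] [NormedSpace ℝ E] [FiniteDimensional ℝ E]
    (hdim : 0 < Module.finrank ℝ E)
    {H : Type*} [TopologicalSpace H] (I : ModelWithCorners ℝ E H)
    {M : Type*} [MetricSpace M] [CompactSpace M] [Nonempty M]
    [ChartedSpace H M] [IsManifold I ∞ M] :
    CompleteSpace (M ≃ₜ M) ∧
    (∀ f : M ≃ₜ M, GenericLyapunov.AdmitsStrictLyapunov f ↔
      GenericLyapunov.generalizedRecurrentSet f ≠ Set.univ) ∧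
    {f : M ≃ₜ M | GenericLyapunov.AdmitsStrictLyapunov f} ∈ residual (M ≃ₜ M) ∧
    {f : M ≃ₜ M | GenericLyapunov.generalizedRecurrentSet f ≠ Set.univ} ∈
      residual (M ≃ₜ M) := by
  have : Nontrivial E := Module.finrank_pos_iff.1 hdim
  have hiff : ∀ f : M ≃ₜ M, GenericLyapunov.AdmitsStrictLyapunov f ↔
      GenericLyapunov.generalizedRecurrentSet f ≠ Set.univ :=
    fun f => GenericLyapunov.admitsStrictLyapunov_iff f
  have hres : {f : M ≃ₜ M | GenericLyapunov.AdmitsStrictLyapunov f} ∈ residual (M ≃ₜ M) :=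
    Filter.mem_of_superset
      (GenericLyapunov.trappingSet_mem_residual (GenericLyapunov.hasDenseCells I))
      fun _ hg => GenericLyapunov.admitsStrictLyapunov_of_mem_trappingSet hg
  exact ⟨GenericLyapunov.completeSpace_homeo, hiff, hres,
    Filter.mem_of_superset hres fun f hf => (hiff f).1 hf⟩
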